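/- Let $N\ge 1$, $s\in(0,1)$, $p\in(1,\infty)$, and let $\Omega\subset\mathbb R^N$ be a bounded open set (not necessarily connected). Let $W^{s,p}_0(\Omega)$ be the space of all $u\in L^p(\mathbb R^N)$ with $u=0$ a.e. in $\mathbb R^N\setminus\Omega$ and $$\|u\|:=\left(\int_{\mathbb R^{2N}}\frac{|u(x)-u(y)|^p}{|x-y|^{N+sp}}\,dx\,dy\right)^{1/p}<\infty ,$$ and for $u,v\in W^{s,p}_0(\Omega)$ put $$\langle A(u),v\rangle:=\int_{\mathbb R^{2N}}\frac{|u(x)-u(y)|^{p-2}(u(x)-u(y))(v(x)-v(y))}{|x-y|^{N+sp}}\,dx\,dy .$$ (Strong minimum principle.) Let $V\in L^1_{\rm loc}(\Omega)$ and let $u\in W^{s,p}_0(\Omega)$ be nonnegative (a.e.) and nontrivial (not a.e. zero), with $Vu^{p-1}\in L^1_{\rm loc}(\Omega)$. Suppose that $$\langle A(u),v\rangle+\int_\Omega Vu^{p-1}v\,dx\ge 0$$ for all $v\in W^{s,p}_0(\Omega)\cap L^\infty_{\rm loc}(\Omega)$ with $v\ge 0$ a.e. and $Vu^{p-1}v\in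 L^1(\Omega)$. Then $u>0$ a.e. in $\Omega$. In particular, nonnegative eigenfunctions are positive: let $\rho(x)=\operatorname{dist}(x,\partial\Omega)$, let $p_s^*=\frac{Np}{N-sp}$ if $sp<N$ and $p_s^*=\infty$ if $sp\ge N$, and let $h$ be a measurable function on $\Omega$ such that $|\{x\in\Omega: h(x)>0\}|>0$ and $h\rho^{sa}\in L^r(\Omega)$ for some $a\in[0,p)$ and $r\in(1,\infty)$ with $\frac1r+\frac ap+\frac{p-a}{p_s^*}<1$. Let $\lambda\in\mathbb R$ and let $\varphi\in W^{s,p}_0(\Omega)$ be an eigenfunction of $(-\Delta)_p^s$ with weight $h$ and eigenvalue $\lambda$, that is, $\varphi$ is nontrivial, $v\mapsto\int_\Omega\lambda h|\varphi|^{p-2}\varphi v\,dx$ is a well-defined (the integrand is in $L^1(\Omega)$ for every $v$) bounded linear functional on $W^{s,p}_0(\Omega)$, and $$\langle A(\varphi),v\rangle=\int_\Omega \lambda h|\varphi|^{p-2}\varphi\, v\,dx\qquad\text{for all } v\in W^{s,p}_0(\Omega).$$ If $\varphi\ge 0$ a.e., then $\varphi>0$ a.e. in $\Omega$. -/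

import Mathlib

open MeasureTheory
open scoped ENNReal

noncomputable section

namespace FracPLap

/-- The Euclidean space `ℝ^N`. Functions are represented by everywhere defined representatives;
all (in)equalities between elements of function spaces are required almost everywhere. -/
abbrev Eu (N : ℕ) : Type := EuclideanSpace ℝ (Fin N)

/-- The energy `∬ |u(x) - u(y)|^p / |x - y|^(N + s p) dx dy` over `ℝ^N × ℝ^N`, in `[0, ∞]`. -/
def gagliardoEnergy {N : ℕ} (s p : ℝ) (u : Eu N → ℝ) : ℝ≥0∞ :=
  ∫⁻ z : Eu N × Eu N,
    ENNReal.ofReal (|u z.1 - u z.2| ^ p / ‖z.1 - z.2‖ ^ ((N : ℝ) + s * p))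

/-- The Gagliardo norm `‖u‖` (a real number, meaningful when the energy is finite). -/
def gagliardoNorm {N : ℕ} (s p : ℝ) (u : Eu N → ℝ) : ℝ :=
  (gagliardoEnergy s p u).toReal ^ (1 / p)

/-- `u ∈ W^{s,p}(ℝ^N)`, for `0 < s < 1 < p < ∞`. -/
def MemW {N : ℕ} (s p : ℝ) (u : Eu N → ℝ) : Prop :=
  MemLp u (ENNReal.ofReal p) volume ∧ gagliardoEnergy s p u < ⊤

/-- `u ∈ W₀^{s,p}(Ω)`: `u ∈ W^{s,p}(ℝ^N)` and `u = 0` (almost everywhere) outside `Ω`. -/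
def MemW0 {N : ℕ} (s p : ℝ) (Ω : Set (Eu N)) (u : Eu N → ℝ) : Prop :=
  MemW s p u ∧ ∀ᵐ x : Eu N, x ∉ Ω → u x = 0

/-- `v ∈ L^∞_loc(Ω)`: `v` is measurable and essentially bounded on every compact subset
of `Ω`. -/
def MemLinftyLoc {N : ℕ} (Ω : Set (Eu N)) (v : Eu N → ℝ) : Prop :=
  ∀ K : Set (Eu N), K ⊆ Ω → IsCompact K → MemLp v ⊤ (volume.restrict K)

/-- The pairing `⟨A(u), v⟩`, i.e. the weak form of `(-Δ)_p^s u` tested with `v`. The integral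
converges absolutely for `u, v ∈ W^{s,p}(ℝ^N)`. -/
def pairingA {N : ℕ} (s p : ℝ) (u v : Eu N → ℝ) : ℝ :=
  ∫ z : Eu N × Eu N,
    |u z.1 - u z.2| ^ (p - 2) * (u z.1 - u z.2) * (v z.1 - v z.2)
      / ‖z.1 - z.2‖ ^ ((N : ℝ) + s * p)

/-- The critical exponent `p_s^* = N p / (N - s p)` if `s p < N`, and `∞` otherwise. -/
def critExp (N : ℕ) (s p : ℝ) : ℝ≥0∞ :=
  if s * p < N then ENNReal.ofReal (N * p / (N - s * p)) else ⊤

/-- The distance `ρ(x) = dist(x, ∂Ω)`. -/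
def rho {N : ℕ} (Ω : Set (Eu N)) (x : Eu N) : ℝ :=
  Metric.infDist x (frontier Ω)

/-- The class `𝒲_q` of weights: `h` is measurable on `Ω` and `h ρ^{s a} ∈ L^r(Ω)` for some
`a ∈ [0, q)` and `r ∈ (1, ∞)` with `1/r + a/p + (q - a)/p_s^* < 1` (where `1/∞ = 0`). -/
def ClassW {N : ℕ} (s p q : ℝ) (Ω : Set (Eu N)) (h : Eu N → ℝ) : Prop :=
  AEMeasurable h (volume.restrict Ω) ∧
  ∃ a r : ℝ, 0 ≤ a ∧ a < q ∧ 1 < r ∧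
    1 / r + a / p + (q - a) * ((critExp N s p)⁻¹).toReal < 1 ∧
    MemLp (fun x => h x * rho Ω x ^ (s * a)) (ENNReal.ofReal r) (volume.restrict Ω)

/-- `g ∈ W₀^{-s,p'}(Ω)`: the function `g` on `Ω` defines, through `v ↦ ∫_Ω g v dx`, a bounded
linear functional on `W₀^{s,p}(Ω)`. -/
def MemDual {N : ℕ} (s p : ℝ) (Ω : Set (Eu N)) (g : Eu N → ℝ) : Prop :=
  (∀ v : Eu N → ℝ, MemW0 s p Ω v → IntegrableOn (fun x => g x * v x) Ω) ∧
  ∃ C : ℝ, ∀ v : Eu N → ℝ, MemW0 s p Ω v →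
    |∫ x in Ω, g x * v x| ≤ C * gagliardoNorm s p v

/-- `u` is a weak solution of `(-Δ)_p^s u = f(x, u)` in `Ω`, `u = 0` in `ℝ^N \ Ω`. -/
def IsWeakSolution {N : ℕ} (s p : ℝ) (Ω : Set (Eu N)) (f : Eu N → ℝ → ℝ)
    (u : Eu N → ℝ) : Prop :=
  MemW0 s p Ω u ∧ MemDual s p Ω (fun x => f x (u x)) ∧
  ∀ v : Eu N → ℝ, MemW0 s p Ω v → pairingA s p u v = ∫ x in Ω, f x (u x) * v x

/-- `u` is an eigenfunction for the eigenvalue `lam` and the weight `h`: a nontrivial weak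
solution of `(-Δ)_p^s u = lam h |u|^{p-2} u` in `Ω`, `u = 0` in `ℝ^N \ Ω`. -/
def IsEigenfunction {N : ℕ} (s p : ℝ) (Ω : Set (Eu N)) (h : Eu N → ℝ) (lam : ℝ)
    (u : Eu N → ℝ) : Prop :=
  IsWeakSolution s p Ω (fun x t => lam * h x * |t| ^ (p - 2) * t) u ∧
  ¬ u =ᵐ[volume] 0

/-- `u` satisfies `(-Δ)_p^s u + V u^{p-1} ≥ 0` weakly in `Ω`: the inequality is tested with all
`v ∈ W₀^{s,p}(Ω) ∩ L^∞_loc(Ω)`, `v ≥ 0`, for which `∫_Ω V u^{p-1} v dx` converges. -/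
def IsWeakSupersolution {N : ℕ} (s p : ℝ) (Ω : Set (Eu N)) (V u : Eu N → ℝ) : Prop :=
  ∀ v : Eu N → ℝ, MemW0 s p Ω v → MemLinftyLoc Ω v → (∀ᵐ x : Eu N, 0 ≤ v x) →
    IntegrableOn (fun x => V x * u x ^ (p - 1) * v x) Ω →
    0 ≤ pairingA s p u v + ∫ x in Ω, V x * u x ^ (p - 1) * v x

end FracPLap

end

/-!
Let `φ` be a Lipschitz cutoff with compact support `S` in `Ω` and `φ = 1` on a compact set `K`.
For `δ > 0`, the function `v = φ^p / (u + δ)^{p-1}` is an admissible test function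
(`memW0_piconeTest`), because it is a Lipschitz function of `(φ, u)` and `φ` has finite energy
(`gagliardoEnergy_lt_top_of_lipschitz`, which is where `0 < s < 1` matters). The discrete Picone
inequality (`picone`) says that
`|u(x) - u(y)|^{p-2} (u(x) - u(y)) (v(x) - v(y)) ≤ |φ(x) - φ(y)|^p`
pointwise. The difference of the two sides, divided by `|x - y|^{N+sp}`, is thus nonnegative, and
the supersolution inequality bounds its integral by the energy of `φ` plus `∫_S |V|`, independently
of `δ`, as `u^{p-1} v ≤ φ^p ≤ 1` (`lintegral_piconeDeficit_le`).

If `x, y ∈ K` with `u(x) = 0` and `u(y) ≥ ε`, that difference is at least a positive constant times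
`(ε / δ)^{p-1} - 1`, which tends to `∞` as `δ → 0` (`le_piconeDeficit`). Hence
`{u = 0} ∩ K` and `{u ≥ ε} ∩ K` cannot both have positive measure
(`volume_zero_mul_volume_superlevel_eq_zero`). The interaction of `x` and `y` is nonlocal, so `K`
and `Ω` need not be connected. Exhausting `Ω` by compact sets gives the strong minimum principle
(`IsWeakSupersolution.ae_pos`).

A nonnegative eigenfunction is a supersolution with potential `V = -λ h`, and `h` is locally
integrable because `ρ` is bounded below on compact subsets of `Ω` (`ClassW.locallyIntegrableOn`).
-/

namespace FracPLap

/-! ### Pointwise inequalities -/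

lemma abs_rpow_sub_two_mul_self {p x : ℝ} (hp : 1 < p) (hx : 0 ≤ x) :
    |x| ^ (p - 2) * x = x ^ (p - 1) := by
  rcases hx.eq_or_lt with rfl | hx
  · simp [Real.zero_rpow (sub_pos.2 hp).ne']
  · rw [abs_of_pos hx, ← Real.rpow_add_one hx.ne']
    ring_nf

/-- The discrete Picone inequality for ordered values, a consequence of the convexity of
`t ↦ t ^ p`. -/
lemma picone_of_le {p a b φ ψ : ℝ} (hp : 1 < p) (hb : 0 < b) (hab : b ≤ a)
    (hφ : 0 ≤ φ) (hψ : 0 ≤ ψ) :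
    (a - b) ^ (p - 1) * (φ ^ p * a ^ (1 - p) - ψ ^ p * b ^ (1 - p)) ≤ |φ - ψ| ^ p := by
  have hp0 : 0 < p := by linarith
  have hrhs : 0 ≤ |φ - ψ| ^ p := by positivity
  rcases hab.eq_or_lt with rfl | hab
  · simpa [Real.zero_rpow (sub_pos.2 hp).ne'] using hrhs
  have ha : 0 < a := hb.trans hab
  have hd : 0 < a - b := sub_pos.2 hab
  rcases le_or_gt φ ψ with h | h
  · refine le_trans (mul_nonpos_of_nonneg_of_nonpos (by positivity) (sub_nonpos.2 ?_)) hrhs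
    exact mul_le_mul (Real.rpow_le_rpow hφ h hp0.le)
      (Real.rpow_le_rpow_of_nonpos hb hab.le (by linarith)) (by positivity) (by positivity)
  -- `φ` is the convex combination of `(φ - ψ) / w₁` and `ψ / w₂` with `w₁ = (a - b) / a`,
  -- `w₂ = b / a`.
  have hx : (φ - ψ) / ((a - b) / a) ∈ Set.Ici (0 : ℝ) := by
    have := sub_pos.2 h
    simp only [Set.mem_Ici]
    positivity
  have hy : ψ / (b / a) ∈ Set.Ici (0 : ℝ) := by
    simp only [Set.mem_Ici]
    positivity
  have key := (convexOn_rpow hp.le).2 hx hy (show 0 ≤ (a - b) / a by positivity)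
    (show 0 ≤ b / a by positivity) (by field_simp; ring)
  have hscale : ∀ w t : ℝ, 0 < w → 0 ≤ t → w * (t / w) ^ p = w ^ (1 - p) * t ^ p := by
    intro w t hw ht
    rw [Real.div_rpow ht hw.le, Real.rpow_sub hw, Real.rpow_one]
    ring
  simp only [smul_eq_mul] at key
  rw [hscale _ _ (by positivity) (sub_pos.2 h).le, hscale _ _ (by positivity) hψ,
    mul_div_cancel₀ _ (by positivity), mul_div_cancel₀ _ (by positivity), sub_add_cancel,
    Real.div_rpow hd.le ha.le, Real.div_rpow hb.le ha.le] at key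
  rw [abs_of_pos (sub_pos.2 h)]
  have e1 : (a - b) ^ (p - 1) * (a - b) ^ (1 - p) = 1 := by
    rw [← Real.rpow_add hd]; simp
  have ha1 : 0 < a ^ (1 - p) := by positivity
  have hd1 : 0 < (a - b) ^ (p - 1) := by positivity
  have key2 := mul_le_mul_of_nonneg_left key (mul_pos hd1 ha1).le
  have e2 : (a - b) ^ (p - 1) * a ^ (1 - p) *
      ((a - b) ^ (1 - p) / a ^ (1 - p) * (φ - ψ) ^ p + b ^ (1 - p) / a ^ (1 - p) * ψ ^ p)
      = ((a - b) ^ (p - 1) * (a - b) ^ (1 - p)) * (φ - ψ) ^ p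
        + (a - b) ^ (p - 1) * (ψ ^ p * b ^ (1 - p)) := by
    field_simp
  rw [e2, e1] at key2
  linarith

/-- The discrete Picone inequality. -/
lemma picone {p a b φ ψ : ℝ} (hp : 1 < p) (ha : 0 < a) (hb : 0 < b)
    (hφ : 0 ≤ φ) (hψ : 0 ≤ ψ) :
    |a - b| ^ (p - 2) * (a - b) * (φ ^ p * a ^ (1 - p) - ψ ^ p * b ^ (1 - p)) ≤ |φ - ψ| ^ p := by
  rcases le_total b a with h | h
  · rw [abs_rpow_sub_two_mul_self hp (sub_nonneg.2 h)]
    exact picone_of_le hp hb h hφ hψ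
  · have := picone_of_le hp ha h hψ hφ
    rw [← abs_rpow_sub_two_mul_self hp (sub_nonneg.2 h), abs_sub_comm ψ φ, abs_sub_comm b a] at this
    linarith

lemma abs_rpow_sub_rpow_le {p s t : ℝ} (hp : 1 ≤ p) (hs : s ∈ Set.Icc (0 : ℝ) 1)
    (ht : t ∈ Set.Icc (0 : ℝ) 1) : |t ^ p - s ^ p| ≤ p * |t - s| := by
  have := (convex_Icc (0 : ℝ) 1).norm_image_sub_le_of_norm_hasDerivWithin_le (C := p)
    (f := fun x => x ^ p) (f' := fun x => p * x ^ (p - 1))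
    (fun x _ => (Real.hasDerivAt_rpow_const (Or.inr hp)).hasDerivWithinAt)
    (fun x hx => by
      rw [Real.norm_of_nonneg (mul_nonneg (by linarith) (Real.rpow_nonneg hx.1 _))]
      exact mul_le_of_le_one_right (by linarith) (Real.rpow_le_one hx.1 hx.2 (by linarith))) hs ht
  simpa [Real.norm_eq_abs] using this

lemma abs_rpow_one_sub_sub_le {p δ s t : ℝ} (hp : 1 ≤ p) (hδ : 0 < δ) (hs : δ ≤ s) (ht : δ ≤ t) :
    |t ^ (1 - p) - s ^ (1 - p)| ≤ (p - 1) * δ ^ (-p) * |t - s| := by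
  have := (convex_Ici δ).norm_image_sub_le_of_norm_hasDerivWithin_le (C := (p - 1) * δ ^ (-p))
    (f := fun x => x ^ (1 - p)) (f' := fun x => (1 - p) * x ^ (1 - p - 1))
    (fun x hx => (Real.hasDerivAt_rpow_const
      (Or.inl (hδ.trans_le hx).ne')).hasDerivWithinAt)
    (fun x hx => by
      have hx0 : 0 < x := hδ.trans_le hx
      rw [norm_mul, Real.norm_of_nonneg (Real.rpow_nonneg hx0.le _), Real.norm_eq_abs,
        abs_sub_comm, abs_of_nonneg (sub_nonneg.2 hp), show 1 - p - 1 = -p by ring]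
      exact mul_le_mul_of_nonneg_left (Real.rpow_le_rpow_of_nonpos hδ hx (by linarith))
        (by linarith)) (Set.mem_Ici.2 hs) (Set.mem_Ici.2 ht)
  simpa [Real.norm_eq_abs] using this

/-- For `δ > 0`, the function `(t, a) ↦ t ^ p * (a + δ) ^ (1 - p)` is Lipschitz on
`[0, 1] × [0, ∞)`. -/
lemma exists_abs_rpow_mul_rpow_sub_le {p δ : ℝ} (hp : 1 ≤ p) (hδ : 0 < δ) :
    ∃ L : ℝ, 0 ≤ L ∧ ∀ s t a b : ℝ, s ∈ Set.Icc (0 : ℝ) 1 → t ∈ Set.Icc (0 : ℝ) 1 → 0 ≤ a → 0 ≤ b →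
      |t ^ p * (a + δ) ^ (1 - p) - s ^ p * (b + δ) ^ (1 - p)| ≤ L * (|t - s| + |a - b|) := by
  refine ⟨p * δ ^ (1 - p) + (p - 1) * δ ^ (-p), by
    have := sub_nonneg.2 hp; positivity, fun s t a b hs ht ha hb => ?_⟩
  have h1 := abs_rpow_sub_rpow_le hp hs ht
  have h2 := abs_rpow_one_sub_sub_le (s := b + δ) (t := a + δ) hp hδ (by linarith) (by linarith)
  rw [add_sub_add_right_eq_sub] at h2
  have h3 : (a + δ) ^ (1 - p) ≤ δ ^ (1 - p) :=
    Real.rpow_le_rpow_of_nonpos hδ (by linarith) (by linarith)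
  have h4 : s ^ p ≤ 1 := Real.rpow_le_one hs.1 hs.2 (by linarith)
  have h5 : 0 ≤ s ^ p := Real.rpow_nonneg hs.1 _
  have h6 : 0 ≤ (a + δ) ^ (1 - p) := by positivity
  have hq : 0 ≤ (p - 1) * δ ^ (-p) := by have := sub_nonneg.2 hp; positivity
  calc |t ^ p * (a + δ) ^ (1 - p) - s ^ p * (b + δ) ^ (1 - p)|
      = |(t ^ p - s ^ p) * (a + δ) ^ (1 - p)
          + s ^ p * ((a + δ) ^ (1 - p) - (b + δ) ^ (1 - p))| := by congr 1; ring
    _ ≤ |t ^ p - s ^ p| * (a + δ) ^ (1 - p)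
          + s ^ p * |(a + δ) ^ (1 - p) - (b + δ) ^ (1 - p)| := by
        refine (abs_add_le _ _).trans ?_
        rw [abs_mul, abs_mul, abs_of_nonneg h5, abs_of_nonneg h6]
    _ ≤ p * |t - s| * δ ^ (1 - p) + 1 * ((p - 1) * δ ^ (-p) * |a - b|) := by
        gcongr
    _ ≤ _ := by
        have := mul_nonneg hq (abs_nonneg (t - s))
        have : 0 ≤ p * δ ^ (1 - p) * |a - b| := by positivity
        nlinarith

lemma add_rpow_le_two_rpow_mul {p a b : ℝ} (hp : 0 ≤ p) (ha : 0 ≤ a) (hb : 0 ≤ b) :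
    (a + b) ^ p ≤ 2 ^ p * (a ^ p + b ^ p) := by
  have hmax : (a + b) ^ p ≤ (2 * max a b) ^ p :=
    Real.rpow_le_rpow (by positivity) (by linarith [le_max_left a b, le_max_right a b]) hp
  rw [Real.mul_rpow two_pos.le (le_max_of_le_left ha)] at hmax
  refine hmax.trans (mul_le_mul_of_nonneg_left ?_ (by positivity))
  have h1 := Real.rpow_nonneg ha p
  have h2 := Real.rpow_nonneg hb p
  rcases max_cases a b with ⟨h, -⟩ | ⟨h, -⟩ <;> rw [h] <;> linarith

/-- A crude form of Young's inequality. -/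
lemma rpow_sub_one_mul_le {p a b : ℝ} (hp : 1 < p) (ha : 0 ≤ a) (hb : 0 ≤ b) :
    a ^ (p - 1) * b ≤ a ^ p + b ^ p := by
  have h1 := Real.rpow_nonneg ha p
  have h2 := Real.rpow_nonneg hb p
  have hpow : ∀ c : ℝ, 0 ≤ c → c ^ (p - 1) * c = c ^ p := by
    intro c hc
    rw [← Real.rpow_add_one' hc (by linarith), sub_add_cancel]
  rcases le_total a b with h | h
  · calc a ^ (p - 1) * b ≤ b ^ (p - 1) * b := by
          gcongr
      _ ≤ _ := by rw [hpow b hb]; linarith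
  · calc a ^ (p - 1) * b ≤ a ^ (p - 1) * a := by gcongr
      _ ≤ _ := by rw [hpow a ha]; linarith

/-! ### Finite energy -/

variable {N : ℕ} {s p : ℝ}

lemma aestronglyMeasurable_gagliardo {u : Eu N → ℝ} (hu : AEStronglyMeasurable u volume) :
    AEStronglyMeasurable
      (fun z : Eu N × Eu N => |u z.1 - u z.2| ^ p / ‖z.1 - z.2‖ ^ ((N : ℝ) + s * p)) volume := by
  have h1 : AEStronglyMeasurable (fun z : Eu N × Eu N => u z.1) volume := hu.comp_fst
  have h2 : AEStronglyMeasurable (fun z : Eu N × Eu N => u z.2) volume := hu.comp_snd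
  have h3 := (h1.sub h2).aemeasurable
  have h4 : Measurable (fun z : Eu N × Eu N => ‖z.1 - z.2‖) := by fun_prop
  have h5 : AEMeasurable (fun z : Eu N × Eu N => |u z.1 - u z.2|) volume :=
    measurable_norm.comp_aemeasurable h3
  exact ((h5.pow_const p).div (h4.pow_const _).aemeasurable).aestronglyMeasurable

lemma gagliardoEnergy_lt_top_iff {u : Eu N → ℝ} (hu : AEStronglyMeasurable u volume) :
    gagliardoEnergy s p u < ⊤ ↔ Integrable
      (fun z : Eu N × Eu N => |u z.1 - u z.2| ^ p / ‖z.1 - z.2‖ ^ ((N : ℝ) + s * p)) := by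
  rw [lt_top_iff_ne_top, gagliardoEnergy]
  exact lintegral_ofReal_ne_top_iff_integrable (aestronglyMeasurable_gagliardo hu)
    (Filter.Eventually.of_forall fun z => by positivity)

/-- The profile of the energy density of a bounded Lipschitz function is integrable over `ℝ^N`:
near `0` because `s < 1`, near infinity because `s > 0`. -/
lemma integrable_min_rpow_div (hN : 1 ≤ N) (hs0 : 0 < s) (hs1 : s < 1) (hp : 1 < p) {L : ℝ}
    (hL : 0 ≤ L) :
    Integrable (fun x : Eu N => min 1 (L * ‖x‖) ^ p / ‖x‖ ^ ((N : ℝ) + s * p)) := by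
  have : Nonempty (Fin N) := ⟨⟨0, hN⟩⟩
  have hp0 : 0 < p := by linarith
  have hmeas : Measurable (fun y : ℝ =>
      y ^ (N - 1) • (min 1 (L * y) ^ p / y ^ ((N : ℝ) + s * p))) := by
    have h1 : Measurable (fun y : ℝ => min 1 (L * y)) := by fun_prop
    exact (measurable_id.pow_const (N - 1)).smul
      ((h1.pow_const p).div (measurable_id.pow_const _))
  have hpow : ∀ y : ℝ, 0 < y → y ^ (N - 1) = y ^ ((N : ℝ) - 1) := by
    intro y _
    rw [← Real.rpow_natCast, Nat.cast_sub hN, Nat.cast_one]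
  refine (integrable_fun_norm_addHaar volume
    (f := fun y : ℝ => min 1 (L * y) ^ p / y ^ ((N : ℝ) + s * p))).2 ?_
  rw [finrank_euclideanSpace_fin, ← Set.Ioc_union_Ioi_eq_Ioi zero_le_one]
  refine IntegrableOn.union ?_ ?_
  · have hint : IntegrableOn (fun y : ℝ => L ^ p * y ^ (p - s * p - 1)) (Set.Ioc 0 1) := by
      have := intervalIntegral.intervalIntegrable_rpow' (a := 0) (b := 1) (r := p - s * p - 1)
        (by nlinarith)
      rw [intervalIntegrable_iff_integrableOn_Ioc_of_le zero_le_one] at this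
      exact this.const_mul _
    refine hint.mono' hmeas.aestronglyMeasurable
      ((ae_restrict_iff' measurableSet_Ioc).2 (Filter.Eventually.of_forall fun y hy => ?_))
    have hy0 : 0 < y := hy.1
    have hm : 0 ≤ min 1 (L * y) := by positivity
    rw [smul_eq_mul, Real.norm_of_nonneg (by positivity), hpow y hy0]
    calc y ^ ((N : ℝ) - 1) * (min 1 (L * y) ^ p / y ^ ((N : ℝ) + s * p))
        ≤ y ^ ((N : ℝ) - 1) * ((L * y) ^ p / y ^ ((N : ℝ) + s * p)) := by
          gcongr
          exact min_le_right _ _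
      _ = L ^ p * (y ^ ((N : ℝ) - 1) * y ^ p / y ^ ((N : ℝ) + s * p)) := by
          rw [Real.mul_rpow hL hy0.le]; ring
      _ = L ^ p * y ^ (p - s * p - 1) := by
          rw [← Real.rpow_add hy0, ← Real.rpow_sub hy0]; congr 2; ring
  · have hint : IntegrableOn (fun y : ℝ => y ^ (-1 - s * p)) (Set.Ioi 1) :=
      integrableOn_Ioi_rpow_of_lt (by nlinarith) one_pos
    refine hint.mono' hmeas.aestronglyMeasurable
      ((ae_restrict_iff' measurableSet_Ioi).2 (Filter.Eventually.of_forall fun y hy => ?_))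
    have hy0 : 0 < y := one_pos.trans hy
    have hm : 0 ≤ min 1 (L * y) := by positivity
    rw [smul_eq_mul, Real.norm_of_nonneg (by positivity), hpow y hy0]
    calc y ^ ((N : ℝ) - 1) * (min 1 (L * y) ^ p / y ^ ((N : ℝ) + s * p))
        ≤ y ^ ((N : ℝ) - 1) * (1 / y ^ ((N : ℝ) + s * p)) := by
          gcongr
          exact Real.rpow_le_one hm (min_le_left _ _) hp0.le
      _ = y ^ (-1 - s * p) := by
          rw [mul_one_div, ← Real.rpow_sub hy0]; congr 1; ring

/-- Lipschitz cutoff functions have finite energy. -/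
lemma gagliardoEnergy_lt_top_of_lipschitz (hN : 1 ≤ N) (hs0 : 0 < s) (hs1 : s < 1) (hp : 1 < p)
    {φ : Eu N → ℝ} {L : NNReal} (hL : LipschitzWith L φ) (hφ : ∀ x, φ x ∈ Set.Icc (0 : ℝ) 1)
    {S : Set (Eu N)} (hS : MeasurableSet S) (hSfin : volume S < ⊤) (hφS : ∀ x ∉ S, φ x = 0) :
    gagliardoEnergy s p φ < ⊤ := by
  set g : Eu N → ℝ≥0∞ :=
    fun x => ENNReal.ofReal (min 1 (L * ‖x‖) ^ p / ‖x‖ ^ ((N : ℝ) + s * p)) with hg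
  have hp0 : 0 < p := by linarith
  have hgm : Measurable g := by
    have h1 : Measurable (fun x : Eu N => min 1 ((L : ℝ) * ‖x‖)) := by fun_prop
    exact ((h1.pow_const p).div (measurable_norm.pow_const _)).ennreal_ofReal
  have hgfin : ∫⁻ x, g x < ⊤ := by
    rw [lt_top_iff_ne_top]
    exact (lintegral_ofReal_ne_top_iff_integrable
      (integrable_min_rpow_div hN hs0 hs1 hp L.2).1
      (Filter.Eventually.of_forall fun x => by
        have : 0 ≤ min 1 ((L : ℝ) * ‖x‖) := by positivity
        positivity)).2 (integrable_min_rpow_div hN hs0 hs1 hp L.2)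
  have hSm : Measurable (S.indicator (1 : Eu N → ℝ≥0∞)) := measurable_one.indicator hS
  have hm1 : Measurable (fun z : Eu N × Eu N => S.indicator 1 z.1 * g (z.1 - z.2)) :=
    (hSm.comp measurable_fst).mul (hgm.comp (measurable_fst.sub measurable_snd))
  have hm2 : Measurable (fun z : Eu N × Eu N => S.indicator 1 z.2 * g (z.1 - z.2)) :=
    (hSm.comp measurable_snd).mul (hgm.comp (measurable_fst.sub measurable_snd))
  have hbound : ∀ z : Eu N × Eu N,
      ENNReal.ofReal (|φ z.1 - φ z.2| ^ p / ‖z.1 - z.2‖ ^ ((N : ℝ) + s * p))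
        ≤ S.indicator 1 z.1 * g (z.1 - z.2) + S.indicator 1 z.2 * g (z.1 - z.2) := by
    intro z
    have hle : ENNReal.ofReal (|φ z.1 - φ z.2| ^ p / ‖z.1 - z.2‖ ^ ((N : ℝ) + s * p))
        ≤ g (z.1 - z.2) := by
      refine ENNReal.ofReal_le_ofReal (div_le_div_of_nonneg_right
        (Real.rpow_le_rpow (abs_nonneg _) (le_min ?_ ?_) hp0.le) (by positivity))
      · rw [abs_le]
        constructor <;> linarith [(hφ z.1).1, (hφ z.1).2, (hφ z.2).1, (hφ z.2).2]
      · simpa [Real.dist_eq, dist_eq_norm] using hL.dist_le_mul z.1 z.2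
    by_cases h1 : z.1 ∈ S
    · refine le_add_right ?_
      simpa [h1] using hle
    by_cases h2 : z.2 ∈ S
    · refine le_add_left ?_
      simpa [h2] using hle
    · simp [hφS _ h1, hφS _ h2, Real.zero_rpow hp0.ne']
  refine (lintegral_mono hbound).trans_lt ?_
  rw [lintegral_add_left hm1, ENNReal.add_lt_top]
  constructor
  · rw [Measure.volume_eq_prod, lintegral_prod _ hm1.aemeasurable]
    have : ∀ x : Eu N, ∫⁻ y, S.indicator 1 x * g (x - y) = S.indicator 1 x * ∫⁻ y, g y := by
      intro x
      have hm : Measurable (fun y => g (x - y)) := hgm.comp (measurable_const.sub measurable_id)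
      rw [lintegral_const_mul _ hm, lintegral_sub_left_eq_self g x]
    simp only [this]
    rw [lintegral_mul_const _ hSm, lintegral_indicator_one hS]
    exact ENNReal.mul_lt_top hSfin hgfin
  · rw [Measure.volume_eq_prod, lintegral_prod_symm _ hm2.aemeasurable]
    have : ∀ y : Eu N, ∫⁻ x, S.indicator 1 y * g (x - y) = S.indicator 1 y * ∫⁻ x, g x := by
      intro y
      have hm : Measurable (fun x => g (x - y)) := hgm.comp (measurable_id.sub measurable_const)
      rw [lintegral_const_mul _ hm, lintegral_sub_right_eq_self g y]
    simp only [this]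
    rw [lintegral_mul_const _ hSm, lintegral_indicator_one hS]
    exact ENNReal.mul_lt_top hSfin hgfin

/-! ### The test functions -/

variable {Ω : Set (Eu N)}

lemma ae_prod_of_ae {P : Eu N → Prop} (h : ∀ᵐ x, P x) :
    ∀ᵐ z : Eu N × Eu N, P z.1 ∧ P z.2 :=
  (Measure.quasiMeasurePreserving_fst.ae h).and (Measure.quasiMeasurePreserving_snd.ae h)

/-- The test function `φ ^ p / (u + δ) ^ (p - 1)` of the Picone argument. -/
noncomputable def piconeTest (p δ : ℝ) (φ u : Eu N → ℝ) (x : Eu N) : ℝ :=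
  φ x ^ p * (u x + δ) ^ (1 - p)

lemma aestronglyMeasurable_piconeTest {δ : ℝ} {φ u : Eu N → ℝ} (hφ : Measurable φ)
    (hu : AEStronglyMeasurable u volume) :
    AEStronglyMeasurable (piconeTest p δ φ u) volume :=
  ((hφ.pow_const p).aemeasurable.mul
    ((hu.aemeasurable.add_const δ).pow_const (1 - p))).aestronglyMeasurable

lemma piconeTest_nonneg {δ : ℝ} (hδ : 0 < δ) {φ u : Eu N → ℝ} (hφ : ∀ x, φ x ∈ Set.Icc (0 : ℝ) 1)
    {x : Eu N} (hx : 0 ≤ u x) : 0 ≤ piconeTest p δ φ u x :=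
  mul_nonneg (Real.rpow_nonneg (hφ x).1 _) (Real.rpow_nonneg (by linarith) _)

lemma piconeTest_le (hp : 1 < p) {δ : ℝ} (hδ : 0 < δ) {φ u : Eu N → ℝ}
    (hφ : ∀ x, φ x ∈ Set.Icc (0 : ℝ) 1)
    {x : Eu N} (hx : 0 ≤ u x) : piconeTest p δ φ u x ≤ δ ^ (1 - p) :=
  calc φ x ^ p * (u x + δ) ^ (1 - p) ≤ 1 * δ ^ (1 - p) :=
        mul_le_mul (Real.rpow_le_one (hφ x).1 (hφ x).2 (by linarith))
          (Real.rpow_le_rpow_of_nonpos hδ (by linarith) (by linarith))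
          (Real.rpow_nonneg (by linarith) _) zero_le_one
    _ = _ := one_mul _

lemma piconeTest_eq_zero (hp : 1 < p) {δ : ℝ} {φ u : Eu N → ℝ} {x : Eu N} (hx : φ x = 0) :
    piconeTest p δ φ u x = 0 := by
  simp [piconeTest, hx, Real.zero_rpow (show p ≠ 0 by linarith)]

lemma memW0_piconeTest (hp : 1 < p) {δ : ℝ} (hδ : 0 < δ) {φ u : Eu N → ℝ}
    (hu : MemW0 s p Ω u) (hu0 : ∀ᵐ x, 0 ≤ u x)
    (hφm : Measurable φ) (hφ : ∀ x, φ x ∈ Set.Icc (0 : ℝ) 1) (hφe : gagliardoEnergy s p φ < ⊤)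
    {S : Set (Eu N)} (hS : MeasurableSet S) (hSfin : volume S < ⊤) (hSΩ : S ⊆ Ω)
    (hφS : ∀ x ∉ S, φ x = 0) : MemW0 s p Ω (piconeTest p δ φ u) := by
  have hp0 : 0 < p := by linarith
  have hvm := aestronglyMeasurable_piconeTest (p := p) (δ := δ) hφm hu.1.1.1
  refine ⟨⟨?_, ?_⟩, Filter.Eventually.of_forall fun x hx =>
    piconeTest_eq_zero hp (hφS x fun h => hx (hSΩ h))⟩
  · refine (memLp_indicator_const (ENNReal.ofReal p) hS (δ ^ (1 - p))
      (Or.inr hSfin.ne)).mono hvm ?_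
    filter_upwards [hu0] with x hx
    rw [Real.norm_of_nonneg (piconeTest_nonneg hδ hφ hx)]
    by_cases h : x ∈ S
    · rw [Set.indicator_of_mem h]
      exact (piconeTest_le hp hδ hφ hx).trans (le_abs_self _)
    · rw [piconeTest_eq_zero hp (hφS x h)]
      exact norm_nonneg _
  · rw [gagliardoEnergy_lt_top_iff hvm]
    obtain ⟨L, hL0, hL⟩ := exists_abs_rpow_mul_rpow_sub_le hp.le hδ
    have h1 := (gagliardoEnergy_lt_top_iff hφm.aestronglyMeasurable).1 hφe
    have h2 := (gagliardoEnergy_lt_top_iff hu.1.1.1).1 hu.1.2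
    refine ((h1.add h2).const_mul (L ^ p * 2 ^ p)).mono' (aestronglyMeasurable_gagliardo hvm) ?_
    filter_upwards [ae_prod_of_ae hu0] with z hz
    rw [Real.norm_of_nonneg (by positivity), Pi.add_apply, ← add_div, mul_div_assoc']
    refine div_le_div_of_nonneg_right ?_ (by positivity)
    calc |piconeTest p δ φ u z.1 - piconeTest p δ φ u z.2| ^ p
        ≤ (L * (|φ z.1 - φ z.2| + |u z.1 - u z.2|)) ^ p :=
          Real.rpow_le_rpow (abs_nonneg _) (hL _ _ _ _ (hφ _) (hφ _) hz.1 hz.2) hp0.le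
      _ = L ^ p * (|φ z.1 - φ z.2| + |u z.1 - u z.2|) ^ p :=
          Real.mul_rpow hL0 (by positivity)
      _ ≤ L ^ p * (2 ^ p * (|φ z.1 - φ z.2| ^ p + |u z.1 - u z.2| ^ p)) := by
          gcongr
          exact add_rpow_le_two_rpow_mul hp0.le (abs_nonneg _) (abs_nonneg _)
      _ = _ := by ring

lemma memLinftyLoc_piconeTest (hp : 1 < p) {δ : ℝ} (hδ : 0 < δ) {φ u : Eu N → ℝ}
    (hu : AEStronglyMeasurable u volume) (hu0 : ∀ᵐ x, 0 ≤ u x)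
    (hφm : Measurable φ) (hφ : ∀ x, φ x ∈ Set.Icc (0 : ℝ) 1) :
    MemLinftyLoc Ω (piconeTest p δ φ u) := by
  intro K _ _
  refine memLp_top_of_bound (aestronglyMeasurable_piconeTest hφm hu).restrict (δ ^ (1 - p))
    (ae_restrict_of_ae ?_)
  filter_upwards [hu0] with x hx
  rw [Real.norm_of_nonneg (piconeTest_nonneg hδ hφ hx)]
  exact piconeTest_le hp hδ hφ hx

/-- The integrand of `⟨A(u), v⟩` is absolutely integrable, by Young's inequality. -/
lemma integrable_pairingA (hp : 1 < p) {u v : Eu N → ℝ} (hu : MemW s p u) (hv : MemW s p v) :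
    Integrable (fun z : Eu N × Eu N =>
      |u z.1 - u z.2| ^ (p - 2) * (u z.1 - u z.2) * (v z.1 - v z.2)
        / ‖z.1 - z.2‖ ^ ((N : ℝ) + s * p)) := by
  have h1 := (gagliardoEnergy_lt_top_iff hu.1.1).1 hu.2
  have h2 := (gagliardoEnergy_lt_top_iff hv.1.1).1 hv.2
  refine (h1.add h2).mono' ?_ (Filter.Eventually.of_forall fun z => ?_)
  · have hd : ∀ w : Eu N → ℝ, AEStronglyMeasurable w volume →
        AEMeasurable (fun z : Eu N × Eu N => w z.1 - w z.2) volume := fun w hw =>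
      ((hw.comp_fst : AEStronglyMeasurable (fun z : Eu N × Eu N => w z.1) volume).sub
        (hw.comp_snd : AEStronglyMeasurable (fun z : Eu N × Eu N => w z.2) volume)).aemeasurable
    have h4 : Measurable (fun z : Eu N × Eu N => ‖z.1 - z.2‖) := by fun_prop
    have h5 : AEMeasurable (fun z : Eu N × Eu N => |u z.1 - u z.2|) volume :=
      measurable_norm.comp_aemeasurable (hd u hu.1.1)
    exact ((((h5.pow_const (p - 2)).mul (hd u hu.1.1)).mul (hd v hv.1.1)).div
      (h4.pow_const _).aemeasurable).aestronglyMeasurable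
  · rw [Pi.add_apply, ← add_div, norm_div, Real.norm_of_nonneg
      (show 0 ≤ ‖z.1 - z.2‖ ^ ((N : ℝ) + s * p) by positivity)]
    refine div_le_div_of_nonneg_right ?_ (by positivity)
    rw [Real.norm_eq_abs, abs_mul, abs_mul,
      abs_of_nonneg (Real.rpow_nonneg (abs_nonneg (u z.1 - u z.2)) _)]
    have := abs_rpow_sub_two_mul_self hp (abs_nonneg (u z.1 - u z.2))
    rw [abs_abs] at this
    rw [this]
    exact rpow_sub_one_mul_le hp (abs_nonneg _) (abs_nonneg _)

/-! ### The Picone deficit -/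

/-- For `v = φ^p / (u + δ)^{p-1}`, the density
`(|φ(x) - φ(y)|^p - |u(x) - u(y)|^{p-2} (u(x) - u(y)) (v(x) - v(y))) / |x - y|^{N+sp}`. It is nonnegative by the discrete Picone inequality. -/
noncomputable def piconeDeficit {N : ℕ} (s p δ : ℝ) (φ u : Eu N → ℝ) (z : Eu N × Eu N) : ℝ :=
  |φ z.1 - φ z.2| ^ p / ‖z.1 - z.2‖ ^ ((N : ℝ) + s * p) -
    |u z.1 - u z.2| ^ (p - 2) * (u z.1 - u z.2) *
      (piconeTest p δ φ u z.1 - piconeTest p δ φ u z.2) / ‖z.1 - z.2‖ ^ ((N : ℝ) + s * p)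

lemma piconeDeficit_nonneg (hp : 1 < p) {δ : ℝ} (hδ : 0 < δ) {φ u : Eu N → ℝ}
    (hφ : ∀ x, φ x ∈ Set.Icc (0 : ℝ) 1) {z : Eu N × Eu N} (h1 : 0 ≤ u z.1) (h2 : 0 ≤ u z.2) :
    0 ≤ piconeDeficit s p δ φ u z := by
  rw [piconeDeficit, ← sub_div]
  refine div_nonneg (sub_nonneg.2 ?_) (by positivity)
  have := picone hp (a := u z.1 + δ) (b := u z.2 + δ) (by linarith) (by linarith)
    (hφ z.1).1 (hφ z.2).1
  rwa [add_sub_add_right_eq_sub] at this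

/-- Where `φ = 1`, the deficit between a zero of `u` and a point with `u ≥ ε` blows up as
`δ → 0`. -/
lemma le_piconeDeficit (hs0 : 0 < s) (hp : 1 < p) {δ ε D : ℝ} (hδ : 0 < δ) (hε : 0 < ε)
    {φ u : Eu N → ℝ} {z : Eu N × Eu N} (hφ1 : φ z.1 = 1) (hφ2 : φ z.2 = 1)
    (h1 : u z.1 = 0) (h2 : ε ≤ u z.2) (hεδ : δ ≤ ε) (hD : ‖z.1 - z.2‖ ≤ D) :
    ((ε / δ) ^ (p - 1) - 1) / D ^ ((N : ℝ) + s * p) ≤ piconeDeficit s p δ φ u z := by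
  have hp0 : 0 < p := by linarith
  have hb : 0 < u z.2 := hε.trans_le h2
  have hne : z.1 ≠ z.2 := fun h => by rw [← h, h1] at hb; exact lt_irrefl _ hb
  have hpos : 0 < ‖z.1 - z.2‖ := norm_pos_iff.2 (sub_ne_zero.2 hne)
  have hp1 : 0 < p - 1 := sub_pos.2 hp
  have hself := abs_rpow_sub_two_mul_self hp hb.le
  rw [piconeDeficit, ← sub_div]
  have hnum : (ε / δ) ^ (p - 1) - 1 ≤ |φ z.1 - φ z.2| ^ p -
      |u z.1 - u z.2| ^ (p - 2) * (u z.1 - u z.2) *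
      (piconeTest p δ φ u z.1 - piconeTest p δ φ u z.2) := by
    simp only [piconeTest, hφ1, hφ2, h1, sub_self, abs_zero, Real.zero_rpow hp0.ne', zero_sub,
      zero_add, Real.one_rpow, one_mul, abs_neg, mul_neg, neg_mul, neg_neg, hself]
    have e1 : u z.2 ^ (p - 1) * δ ^ (1 - p) = (u z.2 / δ) ^ (p - 1) := by
      rw [Real.div_rpow hb.le hδ.le, ← neg_sub p 1, Real.rpow_neg hδ.le, div_eq_mul_inv]
    have e2 : u z.2 ^ (p - 1) * (u z.2 + δ) ^ (1 - p) = (u z.2 / (u z.2 + δ)) ^ (p - 1) := by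
      rw [Real.div_rpow hb.le (by positivity), ← neg_sub p 1, Real.rpow_neg (by positivity),
        div_eq_mul_inv]
    have e3 : (ε / δ) ^ (p - 1) ≤ (u z.2 / δ) ^ (p - 1) := by gcongr
    have e4 : (u z.2 / (u z.2 + δ)) ^ (p - 1) ≤ 1 :=
      Real.rpow_le_one (by positivity) ((div_le_one (by positivity)).2 (by linarith)) hp1.le
    rw [mul_sub, e1, e2]
    linarith
  have hnn : 0 ≤ (ε / δ) ^ (p - 1) - 1 :=
    sub_nonneg.2 (Real.one_le_rpow ((one_le_div hδ).2 hεδ) hp1.le)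
  exact div_le_div₀ (hnn.trans hnum) hnum (by positivity)
    (Real.rpow_le_rpow hpos.le hD (by positivity))

/-- Testing with `φ^p / (u + δ)^{p-1}` bounds the total Picone deficit independently of `δ`. -/
lemma lintegral_piconeDeficit_le (hp : 1 < p) {V u : Eu N → ℝ}
    (hV : LocallyIntegrableOn V Ω) (hu : MemW0 s p Ω u) (hu0 : ∀ᵐ x, 0 ≤ u x)
    (hsup : IsWeakSupersolution s p Ω V u) {φ : Eu N → ℝ}
    (hφm : Measurable φ) (hφ : ∀ x, φ x ∈ Set.Icc (0 : ℝ) 1) (hφe : gagliardoEnergy s p φ < ⊤)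
    {S : Set (Eu N)} (hS : IsCompact S) (hSΩ : S ⊆ Ω) (hφS : ∀ x ∉ S, φ x = 0)
    {δ : ℝ} (hδ : 0 < δ) :
    AEMeasurable (piconeDeficit s p δ φ u) volume ∧
    ∫⁻ z, ENNReal.ofReal (piconeDeficit s p δ φ u z) ≤
      ENNReal.ofReal ((∫ z : Eu N × Eu N, |φ z.1 - φ z.2| ^ p / ‖z.1 - z.2‖ ^ ((N : ℝ) + s * p))
        + ∫ x in S, |V x|) := by
  have hp1 : 0 < p - 1 := sub_pos.2 hp
  have hv := memW0_piconeTest hp hδ hu hu0 hφm hφ hφe hS.measurableSet hS.measure_lt_top hSΩ hφS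
  have hVS : IntegrableOn V S := hV.integrableOn_compact_subset hSΩ hS
  have hS' : Integrable (S.indicator fun x => |V x|) (volume.restrict Ω) :=
    (IntegrableOn.integrable_indicator (f := fun x => |V x|) hVS.abs hS.measurableSet).restrict
  have hle : ∀ᵐ x ∂(volume.restrict Ω), ‖V x * u x ^ (p - 1) * piconeTest p δ φ u x‖
      ≤ S.indicator (fun x => |V x|) x := by
    filter_upwards [ae_restrict_of_ae hu0] with x hx
    by_cases h : x ∈ S
    · rw [Set.indicator_of_mem h, mul_assoc, norm_mul, Real.norm_eq_abs]
      refine mul_le_of_le_one_right (abs_nonneg _) ?_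
      rw [Real.norm_of_nonneg (mul_nonneg (Real.rpow_nonneg hx _) (piconeTest_nonneg hδ hφ hx))]
      have hxδ : 0 < u x + δ := by linarith
      calc u x ^ (p - 1) * (φ x ^ p * (u x + δ) ^ (1 - p))
          = φ x ^ p * (u x / (u x + δ)) ^ (p - 1) := by
            rw [Real.div_rpow hx hxδ.le, ← neg_sub p 1, Real.rpow_neg hxδ.le, div_eq_mul_inv]
            ring
        _ ≤ 1 * 1 := mul_le_mul (Real.rpow_le_one (hφ x).1 (hφ x).2 (by linarith))
            (Real.rpow_le_one (by positivity) ((div_le_one hxδ).2 (by linarith)) hp1.le)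
            (by positivity) zero_le_one
        _ = 1 := one_mul 1
    · rw [piconeTest_eq_zero hp (hφS x h), Set.indicator_of_notMem h, mul_zero, norm_zero]
  have hmeas : AEStronglyMeasurable (fun x => V x * u x ^ (p - 1) * piconeTest p δ φ u x)
      (volume.restrict Ω) :=
    (hV.aestronglyMeasurable.mul
      (hu.1.1.1.aemeasurable.pow_const (p - 1)).aestronglyMeasurable.restrict).mul
      hv.1.1.1.restrict
  have hint : IntegrableOn (fun x => V x * u x ^ (p - 1) * piconeTest p δ φ u x) Ω :=
    hS'.mono' hmeas hle
  have hineq := hsup _ hv (memLinftyLoc_piconeTest hp hδ hu.1.1.1 hu0 hφm hφ)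
    (hu0.mono fun x hx => piconeTest_nonneg hδ hφ hx) hint
  have hVbound : ∫ x in Ω, V x * u x ^ (p - 1) * piconeTest p δ φ u x ≤ ∫ x in S, |V x| := by
    calc ∫ x in Ω, V x * u x ^ (p - 1) * piconeTest p δ φ u x
        ≤ ∫ x in Ω, S.indicator (fun x => |V x|) x :=
          integral_mono_ae hint hS' (hle.mono fun x hx => (le_abs_self _).trans hx)
      _ = ∫ x in S, |V x| := by
          rw [integral_indicator hS.measurableSet, Measure.restrict_restrict hS.measurableSet,
            Set.inter_eq_left.2 hSΩ]
  have h1 := (gagliardoEnergy_lt_top_iff (s := s) (p := p) hφm.aestronglyMeasurable).1 hφe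
  have h2 := integrable_pairingA hp hu.1 hv.1
  have h3 : Integrable (piconeDeficit s p δ φ u) := h1.sub h2
  refine ⟨h3.1.aemeasurable, ?_⟩
  rw [← ofReal_integral_eq_lintegral_ofReal h3 ((ae_prod_of_ae hu0).mono fun z hz =>
    piconeDeficit_nonneg hp hδ hφ hz.1 hz.2)]
  refine ENNReal.ofReal_le_ofReal ?_
  have h4 : ∫ z, piconeDeficit s p δ φ u z =
      (∫ z : Eu N × Eu N, |φ z.1 - φ z.2| ^ p / ‖z.1 - z.2‖ ^ ((N : ℝ) + s * p))
        - pairingA s p u (piconeTest p δ φ u) := integral_sub h1 h2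
  rw [h4]
  linarith

/-! ### The strong minimum principle -/

/-- On a compact set, the zero set and a positive superlevel set of a nonnegative weak
supersolution cannot both have positive measure. -/
lemma volume_zero_mul_volume_superlevel_eq_zero (hN : 1 ≤ N) (hs0 : 0 < s) (hs1 : s < 1)
    (hp : 1 < p) (hΩo : IsOpen Ω) {V u : Eu N → ℝ}
    (hV : LocallyIntegrableOn V Ω) (hu : MemW0 s p Ω u) (hu0 : ∀ᵐ x, 0 ≤ u x)
    (hsup : IsWeakSupersolution s p Ω V u) {K : Set (Eu N)} (hK : IsCompact K) (hKΩ : K ⊆ Ω)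
    {ε : ℝ} (hε : 0 < ε) :
    volume {x ∈ K | u x = 0} * volume {x ∈ K | ε ≤ u x} = 0 := by
  have hp1 : 0 < p - 1 := sub_pos.2 hp
  obtain ⟨η, hη, hηΩ⟩ := hK.exists_cthickening_subset_open hΩo hKΩ
  have hS : IsCompact (Metric.cthickening η K) := hK.cthickening
  set φ : Eu N → ℝ := fun x => thickenedIndicator hη K x with hφdef
  have hφL : LipschitzWith η.toNNReal⁻¹ φ := lipschitzWith_thickenedIndicator hη K
  have hφ : ∀ x, φ x ∈ Set.Icc (0 : ℝ) 1 := fun x =>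
    ⟨NNReal.coe_nonneg _, by exact_mod_cast thickenedIndicator_le_one hη K x⟩
  have hφS : ∀ x ∉ Metric.cthickening η K, φ x = 0 := fun x hx => by
    have := thickenedIndicator_zero hη K fun h => hx (Metric.thickening_subset_cthickening _ _ h)
    simp only [hφdef, this, NNReal.coe_zero]
  have hφ1 : ∀ x ∈ K, φ x = 1 := fun x hx => by
    simp only [hφdef, thickenedIndicator_one hη K hx, NNReal.coe_one]
  have hφm : Measurable φ := hφL.continuous.measurable
  have hφe : gagliardoEnergy s p φ < ⊤ := gagliardoEnergy_lt_top_of_lipschitz hN hs0 hs1 hp hφL hφ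
    hS.measurableSet hS.measure_lt_top hφS
  have hbound := fun (δ : ℝ) (hδ : 0 < δ) => lintegral_piconeDeficit_le hp hV hu hu0 hsup
    hφm hφ hφe hS hηΩ hφS hδ
  generalize (∫ z : Eu N × Eu N, |φ z.1 - φ z.2| ^ p / ‖z.1 - z.2‖ ^ ((N : ℝ) + s * p))
    + ∫ x in Metric.cthickening η K, |V x| = C at hbound
  obtain ⟨D, hD0, hD⟩ := hK.isBounded.subset_ball_lt 0 0
  set Z := {x ∈ K | u x = 0}
  set P := {x ∈ K | ε ≤ u x}
  rw [← Measure.prod_prod, ← Measure.volume_eq_prod]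
  by_contra hne
  set D' : ℝ := (2 * D) ^ ((N : ℝ) + s * p)
  have hD' : 0 < D' := by positivity
  have hmarkov : ∀ T : ℝ, 0 ≤ T → ENNReal.ofReal (T / D') * volume (Z ×ˢ P) ≤ ENNReal.ofReal C := by
    intro T hT
    -- `δ` is chosen so that `(ε / δ) ^ (p - 1) - 1 = T`.
    set M : ℝ := (T + 1) ^ (1 / (p - 1))
    have hM : 1 ≤ M := Real.one_le_rpow (by linarith) (by positivity)
    have hM0 : 0 < M := by linarith
    obtain ⟨hm, hle⟩ := hbound (ε / M) (by positivity)
    have hval : (ε / (ε / M)) ^ (p - 1) - 1 = T := by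
      rw [div_div_cancel₀ hε.ne', ← Real.rpow_mul (by linarith), one_div_mul_cancel hp1.ne',
        Real.rpow_one]
      ring
    refine le_trans ?_ ((mul_meas_ge_le_lintegral₀ hm.ennreal_ofReal
      (ENNReal.ofReal (T / D'))).trans hle)
    gcongr
    rintro z ⟨⟨hz1, hz1'⟩, hz2, hz2'⟩
    refine ENNReal.ofReal_le_ofReal ?_
    rw [← hval]
    refine le_piconeDeficit hs0 hp (by positivity) hε (hφ1 _ hz1) (hφ1 _ hz2) hz1' hz2'
      (div_le_self hε.le hM) ?_
    have d1 := hD hz1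
    have d2 := hD hz2
    rw [mem_ball_zero_iff] at d1 d2
    linarith [norm_sub_le z.1 z.2]
  -- A large enough `T` gives a contradiction.
  have hfin : volume (Z ×ˢ P) ≠ ⊤ := by
    rw [Measure.volume_eq_prod, Measure.prod_prod]
    exact ENNReal.mul_ne_top
      ((measure_mono (Set.sep_subset _ _)).trans_lt hK.measure_lt_top).ne
      ((measure_mono (Set.sep_subset _ _)).trans_lt hK.measure_lt_top).ne
  have hm0 : 0 < (volume (Z ×ˢ P)).toReal := ENNReal.toReal_pos hne hfin
  have h := hmarkov ((|C| + 1) / (volume (Z ×ˢ P)).toReal * D') (by positivity)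
  rw [mul_div_cancel_right₀ _ hD'.ne', ← ENNReal.ofReal_toReal hfin,
    ← ENNReal.ofReal_mul (by positivity), ENNReal.toReal_ofReal hm0.le,
    div_mul_cancel₀ _ hm0.ne'] at h
  have h' := h.trans (ENNReal.ofReal_le_ofReal (le_abs_self C))
  rw [ENNReal.ofReal_le_ofReal_iff (abs_nonneg C)] at h'
  linarith

/-- A nonnegative, nontrivial weak supersolution is positive almost everywhere. -/
lemma IsWeakSupersolution.ae_pos (hN : 1 ≤ N) (hs0 : 0 < s) (hs1 : s < 1)
    (hp : 1 < p) (hΩo : IsOpen Ω) {V u : Eu N → ℝ}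
    (hV : LocallyIntegrableOn V Ω) (hu : MemW0 s p Ω u) (hu0 : ∀ᵐ x, 0 ≤ u x)
    (hne : ¬ u =ᵐ[volume] 0) (hsup : IsWeakSupersolution s p Ω V u) :
    ∀ᵐ x ∂(volume.restrict Ω), 0 < u x := by
  have : LocallyCompactSpace Ω := hΩo.locallyCompactSpace
  set E : ℕ → Set (Eu N) := fun n => Subtype.val '' (compactCovering Ω n)
  have hEc : ∀ n, IsCompact (E n) := fun n =>
    (isCompact_compactCovering Ω n).image continuous_subtype_val
  have hEΩ : ∀ n, E n ⊆ Ω := fun n => by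
    rintro _ ⟨x, -, rfl⟩
    exact x.2
  have hEmem : ∀ x ∈ Ω, ∃ n, x ∈ E n := fun x hx => by
    obtain ⟨n, hn⟩ := exists_mem_compactCovering (⟨x, hx⟩ : Ω)
    exact ⟨n, _, hn, rfl⟩
  obtain ⟨n, k, hnk⟩ : ∃ n k : ℕ, volume {x ∈ E n | 1 / ((k : ℝ) + 1) ≤ u x} ≠ 0 := by
    by_contra! hcon
    refine hne ?_
    have hall : ∀ᵐ x, ∀ n k : ℕ, ¬ (x ∈ E n ∧ 1 / ((k : ℝ) + 1) ≤ u x) :=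
      ae_all_iff.2 fun n => ae_all_iff.2 fun k => by
        rw [ae_iff]
        simpa only [not_not] using hcon n k
    filter_upwards [hall, hu.2, hu0] with x hx hxΩ hx0
    by_contra hxne
    obtain ⟨n, hn⟩ := hEmem x (by_contra fun h => hxne (hxΩ h))
    obtain ⟨k, hk⟩ := exists_nat_one_div_lt (lt_of_le_of_ne hx0 (Ne.symm hxne))
    exact hx n k ⟨hn, hk.le⟩
  -- On `E m ∪ E n` the superlevel set has positive measure, so the zero set is null there.
  have hzero : ∀ m, volume {x ∈ E m | u x = 0} = 0 := by
    intro m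
    have h := volume_zero_mul_volume_superlevel_eq_zero hN hs0 hs1 hp hΩo hV hu hu0 hsup
      ((hEc m).union (hEc n)) (Set.union_subset (hEΩ m) (hEΩ n))
      (show (0 : ℝ) < 1 / ((k : ℝ) + 1) by positivity)
    rcases mul_eq_zero.1 h with h | h
    · exact measure_mono_null (fun x hx => by exact ⟨Or.inl hx.1, hx.2⟩) h
    · exact absurd (measure_mono_null (fun x hx => by exact ⟨Or.inr hx.1, hx.2⟩) h) hnk
  have hall : ∀ᵐ x, ∀ m : ℕ, ¬ (x ∈ E m ∧ u x = 0) := ae_all_iff.2 fun m => by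
    rw [ae_iff]
    simpa only [not_not] using hzero m
  rw [ae_restrict_iff' hΩo.measurableSet]
  filter_upwards [hall, hu0] with x hx hx0 hxΩ
  obtain ⟨m, hm⟩ := hEmem x hxΩ
  exact lt_of_le_of_ne hx0 fun h => hx m ⟨hm, h.symm⟩

/-! ### Eigenfunctions -/

/-- Weights in the class `𝒲_q` are locally integrable, as `ρ` is bounded below on compact
subsets of `Ω`. -/
lemma ClassW.locallyIntegrableOn (hN : 1 ≤ N) (hs0 : 0 < s) {q : ℝ} (hΩo : IsOpen Ω)
    (hΩb : Bornology.IsBounded Ω) {h : Eu N → ℝ} (hh : ClassW s p q Ω h) :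
    LocallyIntegrableOn h Ω := by
  obtain ⟨hm, a, r, ha0, -, hr, -, hLr⟩ := hh
  rw [locallyIntegrableOn_iff (IsOpen.isLocallyClosed hΩo)]
  intro K hKΩ hK
  rcases K.eq_empty_or_nonempty with rfl | hKne
  · exact integrableOn_empty
  have : Nonempty (Fin N) := ⟨⟨0, hN⟩⟩
  have hfr : (frontier Ω).Nonempty := by
    rw [Set.nonempty_iff_ne_empty, Ne, frontier_eq_empty_iff, not_or]
    refine ⟨(hKne.mono hKΩ).ne_empty, fun hu => ?_⟩
    rw [hu] at hΩb
    exact NormedSpace.unbounded_univ ℝ (Eu N) hΩb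
  obtain ⟨x₀, hx₀, hmin⟩ := hK.exists_isMinOn hKne
    (Metric.continuous_infDist_pt (frontier Ω)).continuousOn
  have hρ0 : 0 < rho Ω x₀ := (isClosed_frontier.notMem_iff_infDist_pos hfr).1 fun hx =>
    hΩo.inter_frontier_eq.subset ⟨hKΩ hx₀, hx⟩
  have hsa : 0 ≤ s * a := mul_nonneg hs0.le ha0
  have : IsFiniteMeasure (volume.restrict K) := ⟨by
    rw [Measure.restrict_apply_univ]
    exact hK.measure_lt_top⟩
  have hint : Integrable (fun x => h x * rho Ω x ^ (s * a)) (volume.restrict K) :=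
    (hLr.mono_measure (Measure.restrict_mono hKΩ le_rfl)).integrable
      (by rw [ENNReal.one_le_ofReal]; exact hr.le)
  refine (hint.norm.const_mul ((rho Ω x₀ ^ (s * a))⁻¹)).mono'
    (hm.mono_measure (Measure.restrict_mono hKΩ le_rfl)).aestronglyMeasurable
    ((ae_restrict_iff' hK.measurableSet).2 (Filter.Eventually.of_forall fun x hx => ?_))
  have hle : rho Ω x₀ ^ (s * a) ≤ rho Ω x ^ (s * a) :=
    Real.rpow_le_rpow hρ0.le (isMinOn_iff.1 hmin x hx) hsa
  have hpos : 0 < rho Ω x₀ ^ (s * a) := by positivity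
  rw [norm_mul, Real.norm_of_nonneg (hpos.le.trans hle), inv_mul_eq_div, le_div_iff₀ hpos]
  exact mul_le_mul_of_nonneg_left hle (norm_nonneg _)

end FracPLap

theorem theorem3p3 (N : ℕ) (hN : 1 ≤ N) (s p : ℝ) (hs0 : 0 < s) (hs1 : s < 1) (hp : 1 < p)
    (Ω : Set (FracPLap.Eu N)) (hΩo : IsOpen Ω) (hΩb : Bornology.IsBounded Ω) :
    (∀ V u : FracPLap.Eu N → ℝ,
      LocallyIntegrableOn V Ω →
      FracPLap.MemW0 s p Ω u →
      (∀ᵐ x : FracPLap.Eu N, 0 ≤ u x) →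
      ¬ u =ᵐ[volume] 0 →
      LocallyIntegrableOn (fun x => V x * u x ^ (p - 1)) Ω →
      FracPLap.IsWeakSupersolution s p Ω V u →
      ∀ᵐ x ∂(volume.restrict Ω), 0 < u x) ∧
    (∀ (h φ : FracPLap.Eu N → ℝ) (lam : ℝ),
      FracPLap.ClassW s p p Ω h →
      0 < volume {x ∈ Ω | 0 < h x} →
      FracPLap.IsEigenfunction s p Ω h lam φ →
      (∀ᵐ x : FracPLap.Eu N, 0 ≤ φ x) →
      ∀ᵐ x ∂(volume.restrict Ω), 0 < φ x) := by
  refine ⟨fun V u hV hu hu0 hne _ hsup => hsup.ae_pos hN hs0 hs1 hp hΩo hV hu hu0 hne, ?_⟩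
  rintro h φ lam hh - ⟨⟨hφ, -, hweak⟩, hne⟩ hφ0
  refine FracPLap.IsWeakSupersolution.ae_pos hN hs0 hs1 hp hΩo (V := fun x => -(lam * h x)) ?_
    hφ hφ0 hne fun v hv _ _ _ => ?_
  · intro x hx
    obtain ⟨t, ht, hint⟩ := hh.locallyIntegrableOn hN hs0 hΩo hΩb x hx
    exact ⟨t, ht, (hint.const_mul lam).neg⟩
  · have hneg : ∫ x in Ω, -(lam * h x) * φ x ^ (p - 1) * v x
        = -∫ x in Ω, lam * h x * |φ x| ^ (p - 2) * φ x * v x := by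
      rw [← integral_neg]
      refine integral_congr_ae ((ae_restrict_of_ae hφ0).mono fun x hx => ?_)
      simp only [← FracPLap.abs_rpow_sub_two_mul_self hp hx]
      ring
    rw [hweak v hv, hneg, add_neg_cancel]
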